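/- Let $d\ge 2$, $R\ge 1$, and let $F_1,\dots,F_R\in\mathbb{Z}[x_1,\dots,x_n]$ be homogeneous forms of degree $d$. Let $V(F_1,\dots,F_R)\subset\mathbb{P}^{n-1}_{\mathbb{Q}}$ be the closed subscheme cut out by the forms $F_i$, and let $W\subset\mathbb{P}^{n-1}_{\mathbb{Q}}$ be the projective variety cut out by the condition that the $R\times n$ Jacobian matrix $(\partial F_i/\partial x_j)_{ij}$ has rank less than $R$. Put $$\sigma_{\mathbb{R}} = 1+\max_{\beta\in\mathbb{R}^R\setminus\{0\}}\dim \operatorname{Sing} V(\beta_1F_1+\dots+\beta_RF_R),$$ where $\operatorname{Sing} V(G)\subset\mathbb{P}^{n-1}_{\mathbb{R}}$ denotes the locus in $V(G)$ where all partial derivatives of $G$ vanish (so it is all of $\mathbb{P}^{n-1}_{\mathbb{R}}$ if $G=0$). The empty set has dimension $-1$. If $V(F_1,\dots,F_R)$ is smooth over $\mathbb{Q}$ of dimension $n-1-R$, then $$\sigma_{\mathbb{R}}\le 1+\dim W\le R-1 .$$ -/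

import Mathlib

open MvPolynomial

noncomputable section

namespace FormSystem

variable {k : Type*} [Field k] {n R : ℕ}

/-- The coordinate ring `k[x₁, …, xₙ] / (I, xᵢ - 1)` of the standard affine chart `xᵢ ≠ 0` of the
closed subscheme of projective space `ℙ^{n-1}` over `k` cut out by a homogeneous ideal `I`. These
charts are an open cover of that subscheme. -/
abbrev Chart (I : Ideal (MvPolynomial (Fin n) k)) (i : Fin n) : Type _ :=
  MvPolynomial (Fin n) k ⧸ (I ⊔ Ideal.span {X i - 1})

/-- A Krull dimension as an integer, with the convention that the empty space has dimension `-1`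
(the value at `⊤` is never used, see `krullDim_chart_le`). -/
def dimToInt (m : WithBot ℕ∞) : ℤ :=
  WithBot.recBotCoe (-1) (fun a : ℕ∞ => (a.toNat : ℤ)) m

/-- The dimension of the closed subscheme of `ℙ^{n-1}` cut out by the homogeneous ideal `I`:
the largest Krull dimension of an affine chart, and `-1` if the subscheme is empty. -/
def projDim (I : Ideal (MvPolynomial (Fin n) k)) : ℤ :=
  dimToInt (⨆ i : Fin n, ringKrullDim (Chart I i))

/-- The closed subscheme of `ℙ^{n-1}` cut out by the homogeneous ideal `I` is smooth over `k`. -/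
def IsSmoothProj (I : Ideal (MvPolynomial (Fin n) k)) : Prop :=
  ∀ i : Fin n, Algebra.Smooth k (Chart I i)

/-- The ideal `(F₁, …, F_R)` of `V(F₁, …, F_R)`. -/
def formsIdeal (F : Fin R → MvPolynomial (Fin n) k) : Ideal (MvPolynomial (Fin n) k) :=
  Ideal.span (Set.range F)

/-- The `R × n` Jacobian matrix `(∂Fᵢ/∂xⱼ)`. -/
def jacobian (F : Fin R → MvPolynomial (Fin n) k) :
    Matrix (Fin R) (Fin n) (MvPolynomial (Fin n) k) :=
  Matrix.of fun i j => pderiv j (F i)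

/-- The ideal of the locus `W` where the Jacobian matrix has rank less than `R`, generated by the
`R × R` minors. -/
def rankLocusIdeal (F : Fin R → MvPolynomial (Fin n) k) : Ideal (MvPolynomial (Fin n) k) :=
  Ideal.span (Set.range fun e : Fin R ↪ Fin n => ((jacobian F).submatrix id e).det)

/-- The ideal of the singular locus of the hypersurface `V(G)`: the points of `V(G)` at which all
partial derivatives of `G` vanish. For `G = 0` this locus is the whole of `ℙ^{n-1}`. -/
def singIdeal (G : MvPolynomial (Fin n) k) : Ideal (MvPolynomial (Fin n) k) :=
  Ideal.span {G} ⊔ Ideal.span (Set.range fun j => pderiv j G)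

/-- The real form `β₁F₁ + ⋯ + β_R F_R`. -/
def realCombination (F : Fin R → MvPolynomial (Fin n) ℤ) (β : Fin R → ℝ) :
    MvPolynomial (Fin n) ℝ :=
  ∑ i, C (β i) * map (Int.castRingHom ℝ) (F i)

/-- The values `dim Sing V(β · F)` for nonzero real vectors `β`. -/
def singDims (F : Fin R → MvPolynomial (Fin n) ℤ) : Set ℤ :=
  {m | ∃ β : Fin R → ℝ, β ≠ 0 ∧ m = projDim (singIdeal (realCombination F β))}

/-- `σ_ℝ = 1 + max_{β ≠ 0} dim Sing V(β · F)`; the maximum is attained, see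
`isGreatest_sSup_singDims`. -/
def sigmaReal (F : Fin R → MvPolynomial (Fin n) ℤ) : ℤ :=
  1 + sSup (singDims F)

/-- The system `F` with its integer coefficients read in `ℚ`. -/
def overRat (F : Fin R → MvPolynomial (Fin n) ℤ) : Fin R → MvPolynomial (Fin n) ℚ :=
  fun i => map (Int.castRingHom ℚ) (F i)

theorem krullDim_chart_le (I : Ideal (MvPolynomial (Fin n) k)) :
    ⨆ i : Fin n, ringKrullDim (Chart I i) ≤ (n : WithBot ℕ∞) := by
  refine iSup_le fun i => (ringKrullDim_quotient_le _).trans ?_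
  simp

theorem projDim_le (I : Ideal (MvPolynomial (Fin n) k)) : projDim I ≤ n := by
  have h := krullDim_chart_le I
  unfold projDim dimToInt
  generalize (⨆ i : Fin n, ringKrullDim (Chart I i)) = m at h
  induction m with
  | bot => simp
  | coe a =>
    have h' : a ≤ (n : ℕ∞) := by exact_mod_cast h
    simpa using ENat.toNat_le_of_le_natCast h'

theorem isGreatest_sSup_singDims (hR : 1 ≤ R) (F : Fin R → MvPolynomial (Fin n) ℤ) :
    IsGreatest (singDims F) (sSup (singDims F)) := by
  have hne : (singDims F).Nonempty :=
    ⟨_, fun _ => 1, fun h => one_ne_zero (congrFun h ⟨0, hR⟩), rfl⟩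
  have hb : BddAbove (singDims F) := ⟨n, by rintro m ⟨β, -, rfl⟩; exact projDim_le _⟩
  exact ⟨Int.csSup_mem hne hb, fun m hm => le_csSup hb hm⟩

end FormSystem

end

/-!
Everything is done with points over extension fields and with transcendence degrees, in
characteristic zero. Write `V` for the locus `F = 0` and `W` for the locus where the Jacobian matrix
drops rank.

*`V` and `W` are disjoint.* At a common point with values in a field `κ`, the tangent space of a
chart of `V` has dimension at least `n - R`. Since the chart is smooth, Kähler differentials near
the point have a basis consisting of exact differentials `da₁, …, da_s`, so `s ≥ n - R`. In
characteristic zero linearly independent differentials have algebraically independent primitives,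
and the Krull dimension of the chart bounds `s`; this contradicts `dim V = n - 1 - R`
(`exists_minor_ne_zero`).

*Consequence for the affine cone over `W`.* If `ξ` is a point of this cone with coordinates in a
field `K`, then all `ξⱼ` are integral over `k[F₁(ξ), …, F_R(ξ)]`: otherwise some valuation ring of
`K` contains the `F_l(ξ)` but not all `ξⱼ`, and dividing `ξ` by its largest coordinate and reducing
modulo the maximal ideal gives a common point of `V` and `W` (`isIntegral_of_minors_eq_zero`).
Hence, if `K = k(ξ)` had transcendence degree at least `R`, the `F_l(ξ)` would be a transcendence
basis, so their differentials would be linearly independent; but these are combinations of the `dξⱼ`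
whose coefficient matrix is the Jacobian at `ξ`, which has rank less than `R`
(`card_lt_of_minors_eq_zero`). The integrality alone bounds the dimension of `W` by `R - 1`; the
differentials account for the improvement to `R - 2`.

*From the cone to `W`.* A chart of `W` of dimension `s` yields a point of the cone over a field of
transcendence degree `s + 1`, the additional parameter being the scaling factor, so `s + 1 < R`
(`chart_rankLocus_dim_lt`).

*The real form.* If `β ≠ 0`, a point where all `∂ⱼ(β · F)` vanish has linearly dependent rows in its
Jacobian matrix, so `Sing V(β · F)` lies in the base change of `W` to `ℝ`
(`map_rankLocusIdeal_le_singIdeal`), and dimensions do not grow under base change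
(`projDim_le_of_map_le`).
-/

namespace FormSystem

/-! ### Krull dimension and algebraic independence -/

theorem ringKrullDim_le_of_isIntegral (S B : Type*) [CommRing S] [CommRing B] [Algebra S B]
    [Algebra.IsIntegral S B] : ringKrullDim B ≤ ringKrullDim S := by
  refine Order.krullDim_le_of_strictMono (PrimeSpectrum.comap (algebraMap S B)) ?_
  intro p q h
  exact Ideal.IsIntegral.comap_lt_comap (R := S) (I := p.asIdeal) (J := q.asIdeal) h

theorem ringKrullDim_le_of_isIntegral_of_injective (S B : Type*) [CommRing S] [CommRing B]
    [Algebra S B] [Algebra.IsIntegral S B] (h : Function.Injective (algebraMap S B)) :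
    ringKrullDim S ≤ ringKrullDim B := by
  refine iSup_le fun l => ?_
  obtain ⟨P, -, hP, hPl⟩ := Ideal.exists_ideal_over_prime_of_isIntegral (S := B) l.head.asIdeal ⊥
    (by rw [← RingHom.ker, (RingHom.injective_iff_ker_eq_bot _).1 h]; exact bot_le)
  have : P.LiesOver l.head.asIdeal := ⟨hPl.symm⟩
  obtain ⟨M, hM, -⟩ := Ideal.exists_ltSeries_of_hasGoingUp l P
  exact hM ▸ le_iSup (fun p : LTSeries (PrimeSpectrum B) => (p.length : WithBot ℕ∞)) M

/-- Noether normalization, with the number of variables identified as the Krull dimension. -/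
theorem exists_integral_inj_ringKrullDim_eq (k B : Type*) [Field k] [CommRing B] [Nontrivial B]
    [Algebra k B] [Algebra.FiniteType k B] :
    ∃ (s : ℕ) (g : MvPolynomial (Fin s) k →ₐ[k] B), Function.Injective g ∧
      g.toRingHom.IsIntegral ∧ ringKrullDim B = s := by
  obtain ⟨s, g, hg, hi⟩ := exists_integral_inj_algHom_of_fg k B
  refine ⟨s, g, hg, hi, ?_⟩
  let := g.toRingHom.toAlgebra
  have : Algebra.IsIntegral (MvPolynomial (Fin s) k) B := ⟨hi⟩
  have : ringKrullDim (MvPolynomial (Fin s) k) = s := by simp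
  rw [← this]
  exact le_antisymm (ringKrullDim_le_of_isIntegral _ _)
    (ringKrullDim_le_of_isIntegral_of_injective _ _ hg)

/-- An algebraically independent family stays so modulo a suitable prime: a minimal prime of `B`
lying over the zero ideal of the polynomial ring generated by the family. -/
theorem exists_isPrime_algebraicIndependent_quotient {k B ι : Type*} [Field k] [CommRing B]
    [Algebra k B] {x : ι → B} (hx : AlgebraicIndependent k x) :
    ∃ p : Ideal B, p.IsPrime ∧ AlgebraicIndependent k fun i => Ideal.Quotient.mk p (x i) := by
  have hinj : Function.Injective (aeval (R := k) x).toRingHom := hx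
  obtain ⟨p, hp, hpx⟩ := Ideal.exists_comap_eq_of_mem_minimalPrimes_of_injective hinj ⊥
    (by rw [IsDomain.minimalPrimes_eq_singleton_bot]; rfl)
  refine ⟨p, hp, ?_⟩
  rw [AlgebraicIndependent, injective_iff_map_eq_zero]
  intro a ha
  have h1 : Ideal.Quotient.mkₐ k p (aeval x a) = 0 := by
    rw [← ha]
    exact DFunLike.congr_fun (comp_aeval x (Ideal.Quotient.mkₐ k p)) a
  have : a ∈ p.comap (aeval (R := k) x).toRingHom :=
    Ideal.mem_comap.2 (Ideal.Quotient.eq_zero_iff_mem.1 h1)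
  rw [hpx] at this
  simpa using this

/-- The ring `B` need not be a domain, so its dimension is compared with the transcendence degree of
a quotient by a prime. -/
theorem card_le_of_algebraicIndependent {k B ι : Type*} [Field k] [CommRing B] [Algebra k B]
    [Algebra.FiniteType k B] [Fintype ι] {x : ι → B} (hx : AlgebraicIndependent k x) :
    (Fintype.card ι : WithBot ℕ∞) ≤ ringKrullDim B := by
  obtain ⟨p, hp, hy⟩ := exists_isPrime_algebraicIndependent_quotient hx
  obtain ⟨s, g, hg, hi, hs⟩ := exists_integral_inj_ringKrullDim_eq k (B ⧸ p)
  refine le_trans ?_ (ringKrullDim_quotient_le p)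
  rw [hs]
  let := g.toRingHom.toAlgebra
  have : IsScalarTower k (MvPolynomial (Fin s) k) (B ⧸ p) :=
    .of_algebraMap_eq' g.comp_algebraMap.symm
  have : Algebra.IsIntegral (MvPolynomial (Fin s) k) (B ⧸ p) := ⟨hi⟩
  have : FaithfulSMul (MvPolynomial (Fin s) k) (B ⧸ p) :=
    (faithfulSMul_iff_algebraMap_injective _ _).2 hg
  have h1 := hy.lift_cardinalMk_le_trdeg
  have h2 := lift_trdeg_add_eq k (MvPolynomial (Fin s) k) (B ⧸ p)
  rw [trdeg_eq_zero (R := MvPolynomial (Fin s) k) (A := B ⧸ p),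
    MvPolynomial.trdeg_of_isDomain] at h2
  simp only [Cardinal.mk_fin, Cardinal.lift_natCast, Cardinal.lift_zero, add_zero] at h2
  rw [← Cardinal.lift_natCast.{_, 0}, ← Cardinal.lift_inj.{_, 0}] at h2
  have h3 : Algebra.trdeg k (B ⧸ p) = s := by simpa using h2.symm
  rw [h3] at h1
  simp only [Cardinal.mk_fintype, Cardinal.lift_natCast, Nat.cast_le] at h1
  exact_mod_cast h1

/-! ### Differentials and algebraic independence -/

/-- The chain rule for a derivation and a polynomial in several variables. -/
theorem derivation_aeval {k L M ι : Type*} [Field k] [CommRing L] [Algebra k L] [AddCommGroup M]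
    [Module k M] [Module L M] [IsScalarTower k L M] [Fintype ι] (δ : Derivation k L M) (y : ι → L)
    (G : MvPolynomial ι k) : δ (aeval y G) = ∑ i, aeval y (pderiv i G) • δ (y i) := by
  classical
  induction G using MvPolynomial.induction_on with
  | C a => simp
  | add p q hp hq => simp [hp, hq, add_smul, Finset.sum_add_distrib]
  | mul_X p j hp =>
    simp only [map_mul, aeval_X, Derivation.leibniz, hp, pderiv_X, smul_eq_mul, map_add, add_smul,
      Finset.sum_add_distrib, Finset.smul_sum, mul_smul]
    congr 1
    rw [Finset.sum_eq_single j] <;> simp +contextual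

theorem totalDegree_pderiv_lt {k ι : Type*} [Field k] {G : MvPolynomial ι k} {i : ι}
    (h : pderiv i G ≠ 0) : (pderiv i G).totalDegree < G.totalDegree := by
  classical
  have hlt : ∀ m ∈ (pderiv i G).support, (m.sum fun _ e => e) < G.totalDegree := by
    intro m hm
    rw [mem_support_iff, coeff_pderiv] at hm
    have := le_totalDegree (mem_support_iff.2 (left_ne_zero_of_mul hm))
    rw [Finsupp.sum_add_index' (by simp) (by simp)] at this
    simp only [Finsupp.sum_single_index] at this
    omega
  obtain ⟨m, hm⟩ := support_nonempty.2 h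
  exact (Finset.sup_lt_iff (bot_lt_of_lt (hlt m hm))).2 hlt

theorem eq_C_of_pderiv_eq_zero {k ι : Type*} [Field k] [CharZero k] {G : MvPolynomial ι k}
    (h : ∀ i, pderiv i G = 0) : G = C (coeff 0 G) := by
  classical
  ext m
  rw [coeff_C]
  split_ifs with hm
  · rw [hm]
  obtain ⟨i, hi⟩ : ∃ i, m i ≠ 0 := by
    by_contra! hc
    exact hm (Finsupp.ext fun i => (hc i).symm)
  have h1 := coeff_pderiv (i := i) G (m - Finsupp.single i 1)
  rw [h i, coeff_zero, tsub_add_cancel_of_le (by simpa using Nat.one_le_iff_ne_zero.2 hi)] at h1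
  exact (mul_eq_zero.1 h1.symm).resolve_right (Nat.cast_add_one_ne_zero _)

/-- In characteristic zero, elements with linearly independent differentials are algebraically
independent, even if `L` is not a domain: the partial derivatives of a relation are again
relations. -/
theorem algebraicIndependent_of_linearIndependent_D {k L ι : Type*} [Field k] [CharZero k]
    [CommRing L] [Nontrivial L] [Algebra k L] [Finite ι] {y : ι → L}
    (h : LinearIndependent L fun i => KaehlerDifferential.D k L (y i)) :
    AlgebraicIndependent k y := by
  have := Fintype.ofFinite ι
  rw [AlgebraicIndependent, injective_iff_map_eq_zero]
  intro G hG
  induction hN : G.totalDegree using Nat.strong_induction_on generalizing G with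
  | _ N ih =>
    have hp : ∀ i, pderiv i G = 0 := by
      intro i
      by_contra hi
      refine hi (ih _ (hN ▸ totalDegree_pderiv_lt hi) _ ?_ rfl)
      have h1 := derivation_aeval (KaehlerDifferential.D k L) y G
      rw [hG, map_zero] at h1
      exact Fintype.linearIndependent_iff.1 h _ h1.symm i
    rw [eq_C_of_pderiv_eq_zero hp] at hG ⊢
    simpa using hG

open KaehlerDifferential in
/-- For a smooth `k`-algebra `A` and a point of `A` with values in a field `κ`, there are
algebraically independent elements of `A` whose differentials generate the cotangent space at that point. In
particular their number is at least the dimension of the tangent space `Der_k(A, κ)`. -/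
theorem exists_algebraicIndependent_of_smooth {k : Type*} {A : Type*} {κ : Type*} [Field k]
    [CharZero k] [CommRing A] [Algebra k A] [Algebra.Smooth k A] [Field κ] [Algebra k κ]
    [Algebra A κ] [IsScalarTower k A κ] :
    ∃ (s : ℕ) (a : Fin s → A), AlgebraicIndependent k a ∧
      ∀ δ : Derivation k A κ, (∀ i, δ (a i) = 0) → δ = 0 := by
  let P : Ideal A := RingHom.ker (algebraMap A κ)
  have : P.IsPrime := RingHom.ker_isPrime _
  let L := Localization.AtPrime P
  obtain ⟨ι, a, b, hb⟩ := Module.exists_basis_of_span_of_flat _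
    (span_range_map_derivation_of_isLocalization k A L P.primeCompl)
  have hfin : Finite ι := Module.Finite.finite_basis b
  have hb' : ∀ i, b i = D k L (algebraMap A L (a i)) := by
    intro i; rw [hb]; simp
  have hLind : LinearIndependent L fun i => D k L (algebraMap A L (a i)) := by
    simpa only [← hb'] using b.linearIndependent
  have hind := algebraicIndependent_of_linearIndependent_D hLind
  have hinda : AlgebraicIndependent k a :=
    AlgebraicIndependent.of_comp (f := IsScalarTower.toAlgHom k A L) hind
  have hu : ∀ x : P.primeCompl, IsUnit (algebraMap A κ x) := by
    intro x
    exact isUnit_iff_ne_zero.2 fun h => x.2 h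
  have key : ∀ δ : Derivation k A κ, (∀ i, δ (a i) = 0) → δ = 0 := by
    intro δ hδ
    have hu' : ∀ x : P.primeCompl, IsUnit (algebraMap A (Module.End A κ) x) := by
      intro x
      rw [Module.End.isUnit_iff]
      have hx := (hu x).ne_zero
      refine ⟨fun y z h => mul_left_cancel₀ hx ?_, fun y => ⟨(algebraMap A κ x)⁻¹ * y, ?_⟩⟩
      · simpa [Algebra.smul_def] using h
      · simp [Algebra.smul_def, hx]
    -- Extend `δ` to an `L`-linear map on `Ω[L⁄k]`; it vanishes on the basis `b`.
    let := (IsLocalization.lift (S := L) hu).toAlgebra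
    have : IsScalarTower A L κ := .of_algebraMap_eq' (IsLocalization.lift_comp hu).symm
    let ℓ : Ω[L⁄k] →ₗ[A] κ := IsLocalizedModule.lift P.primeCompl (map k k A L)
      δ.liftKaehlerDifferential hu'
    let ℓ' : Ω[L⁄k] →ₗ[L] κ := ℓ.extendScalarsOfIsLocalization P.primeCompl L
    have hℓ : ∀ x, ℓ (D k L (algebraMap A L x)) = δ x := by
      intro x
      have := IsLocalizedModule.lift_apply P.primeCompl (map k k A L)
        δ.liftKaehlerDifferential hu' (D k A x)
      simpa using this
    have h0 : ℓ' = 0 := by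
      refine b.ext fun i => ?_
      rw [hb']
      exact (hℓ (a i)).trans (hδ i)
    ext x
    rw [← hℓ]
    exact DFunLike.congr_fun h0 _
  let e := Finite.equivFin ι
  refine ⟨Nat.card ι, a ∘ e.symm, hinda.comp _ e.symm.injective, fun δ h => key δ fun i => ?_⟩
  simpa using h (e i)

open KaehlerDifferential in
/-- In characteristic zero `K` is formally étale over the polynomial ring on a transcendence basis, so
`Ω[K⁄k]` is obtained from that of the polynomial ring by base change. -/
theorem linearIndependent_D_of_isTranscendenceBasis {k K ι : Type*} [Field k] [CharZero k]
    [Field K] [Algebra k K] {f : ι → K} (hf : IsTranscendenceBasis k f) :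
    LinearIndependent K fun i => D k K (f i) := by
  let S := MvPolynomial ι k
  let := (aeval (R := k) f).toRingHom.toAlgebra
  have : IsScalarTower k S K := .of_algebraMap_eq' (aeval (R := k) f).comp_algebraMap.symm
  have : FaithfulSMul S K := (faithfulSMul_iff_algebraMap_injective _ _).2 hf.1
  let := FractionRing.liftAlgebra S K
  have : IsScalarTower S (FractionRing S) K := inferInstance
  have : Algebra.IsAlgebraic S K :=
    (Algebra.isAlgebraic_ringHom_iff_of_comp_eq hf.1.aevalEquiv (RingEquiv.refl K)
      (RingHom.ext fun p => by
        simp; rfl)).1 hf.isAlgebraic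
  have : Algebra.IsAlgebraic (FractionRing S) K :=
    Algebra.IsAlgebraic.extendScalars (R := S) (IsFractionRing.injective S (FractionRing S))
  have : CharZero (FractionRing S) :=
    charZero_of_injective_algebraMap (R := k) (algebraMap k (FractionRing S)).injective
  have : Algebra.FormallyEtale (FractionRing S) K := Algebra.FormallyEtale.of_isSeparable _ _
  have : Algebra.FormallyEtale S (FractionRing S) :=
    Algebra.FormallyEtale.of_isLocalization (nonZeroDivisors S)
  have : Algebra.FormallyEtale S K := Algebra.FormallyEtale.comp S (FractionRing S) K
  have h := (((mvPolynomialBasis k ι).baseChange K).map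
    (tensorKaehlerEquivOfFormallyEtale k S K)).linearIndependent
  convert h with i
  rw [Module.Basis.map_apply, Module.Basis.baseChange_apply, mvPolynomialBasis_apply,
    tensorKaehlerEquivOfFormallyEtale_apply, mapBaseChange_tmul, one_smul, map_D]
  exact congrArg _ (aeval_X f i).symm

/-! ### Matrices with vanishing maximal minors -/

theorem rank_lt_of_minors_eq_zero {κ : Type*} [Field κ] {R n : ℕ} (M : Matrix (Fin R) (Fin n) κ)
    (h : ∀ e : Fin R ↪ Fin n, (M.submatrix id e).det = 0) : M.rank < R := by
  refine lt_of_le_of_ne (by simpa using M.rank_le_height) fun hr => ?_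
  obtain ⟨ι, a, ha, hsp, hli⟩ := exists_linearIndependent' κ M.col
  have : Finite ι := Finite.of_injective a ha
  have := Fintype.ofFinite ι
  have hc : Fintype.card ι = R := by
    rw [← finrank_span_eq_card hli, hsp, ← Matrix.rank_eq_finrank_span_cols, hr]
  let f := (Fintype.equivFinOfCardEq hc).symm
  have hu : LinearIndependent κ (M.submatrix id (a ∘ f)).col := hli.comp f f.injective
  rw [Matrix.linearIndependent_cols_iff_isUnit, Matrix.isUnit_iff_isUnit_det] at hu
  exact hu.ne_zero (h ⟨a ∘ f, ha.comp f.injective⟩)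

variable {k : Type*} [Field k] {n R : ℕ}

/-! ### Dimensions of projective schemes -/

theorem le_projDim {I : Ideal (MvPolynomial (Fin n) k)} {i : Fin n}
    {s : ℕ} (h : (s : WithBot ℕ∞) ≤ ringKrullDim (Chart I i)) : (s : ℤ) ≤ projDim I := by
  have h1 := krullDim_chart_le I
  replace h := h.trans (le_iSup (fun i => ringKrullDim (Chart I i)) i)
  unfold projDim dimToInt
  generalize (⨆ i : Fin n, ringKrullDim (Chart I i)) = m at h h1
  induction m with
  | bot => simp at h
  | coe a =>
    have h' : a ≤ (n : ℕ∞) := by exact_mod_cast h1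
    lift a to ℕ using ne_top_of_le_ne_top (ENat.natCast_ne_top n) h'
    have : s ≤ a := by exact_mod_cast h
    change (s : ℤ) ≤ ((a : ℕ∞).toNat : ℤ)
    simpa using this

theorem neg_one_le_projDim (I : Ideal (MvPolynomial (Fin n) k)) :
    -1 ≤ projDim I := by
  unfold projDim dimToInt
  generalize (⨆ i : Fin n, ringKrullDim (Chart I i)) = m
  induction m with
  | bot => simp
  | coe a => simp

theorem projDim_le_of_chart {I : Ideal (MvPolynomial (Fin n) k)}
    {N : ℤ} (hN : -1 ≤ N) (h : ∀ i, Nontrivial (Chart I i) → ∀ s : ℕ,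
      ringKrullDim (Chart I i) = s → (s : ℤ) ≤ N) : projDim I ≤ N := by
  have key : ∀ i, ringKrullDim (Chart I i) ≠ ⊥ →
      ∃ s : ℕ, ringKrullDim (Chart I i) = s ∧ (s : ℤ) ≤ N := by
    intro i hi
    have hnt : Nontrivial (Chart I i) := by
      by_contra hc
      have := not_nontrivial_iff_subsingleton.1 hc
      exact hi ringKrullDim_eq_bot_of_subsingleton
    obtain ⟨s, -, -, -, hs⟩ := exists_integral_inj_ringKrullDim_eq k (Chart I i)
    exact ⟨s, hs, h i hnt s hs⟩
  rcases hN.eq_or_lt with rfl | hN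
  · have : (⨆ i : Fin n, ringKrullDim (Chart I i)) = ⊥ := by
      rw [iSup_eq_bot]
      intro i
      by_contra hi
      obtain ⟨s, -, hs⟩ := key i hi
      omega
    rw [projDim, this]
    simp [dimToInt]
  · lift N to ℕ using (by omega)
    have hle : (⨆ i : Fin n, ringKrullDim (Chart I i)) ≤ (N : WithBot ℕ∞) := by
      refine iSup_le fun i => ?_
      by_cases hi : ringKrullDim (Chart I i) = ⊥
      · simp [hi]
      obtain ⟨s, hs, hsN⟩ := key i hi
      rw [hs]
      exact_mod_cast hsN
    unfold projDim dimToInt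
    generalize (⨆ i : Fin n, ringKrullDim (Chart I i)) = m at hle
    induction m with
    | bot => simp
    | coe a =>
      have h' : a ≤ (N : ℕ∞) := by exact_mod_cast hle
      simpa using ENat.toNat_le_of_le_natCast h'

/-! ### The singular points of a smooth complete intersection -/

/-- The `k`-linear map `q ↦ ∑ⱼ (∂q/∂xⱼ)(η) vⱼ`, the derivative at `η` in the direction `v`. -/
noncomputable def dirDeriv {κ : Type*} [Field κ] [Algebra k κ] (η v : Fin n → κ) :
    MvPolynomial (Fin n) k →ₗ[k] κ where
  toFun q := ∑ j, aeval η (pderiv j q) * v j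
  map_add' p q := by simp [add_mul, Finset.sum_add_distrib]
  map_smul' c q := by simp [Finset.smul_sum]

theorem dirDeriv_mul {κ : Type*} [Field κ] [Algebra k κ] (η v : Fin n → κ)
    (p q : MvPolynomial (Fin n) k) :
    dirDeriv η v (p * q) = aeval η p * dirDeriv η v q + aeval η q * dirDeriv η v p := by
  simp only [dirDeriv, LinearMap.coe_mk, AddHom.coe_mk, Derivation.leibniz, smul_eq_mul, map_add,
    map_mul, add_mul, Finset.sum_add_distrib, Finset.mul_sum, mul_assoc]

theorem dirDeriv_X {κ : Type*} [Field κ] [Algebra k κ] (η v : Fin n → κ) (i : Fin n) :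
    dirDeriv (k := k) η v (X i) = v i := by
  classical
  simp [dirDeriv, pderiv_X, Pi.single_apply, apply_ite]

/-- A tangent vector `v` at a point `η` of `V(I)`, given by equations on generators of `I`, defines a
derivation of the coordinate ring. -/
theorem exists_derivation_quotient {κ : Type*} [Field κ] [Algebra k κ] (η v : Fin n → κ)
    (I : Ideal (MvPolynomial (Fin n) k)) [Algebra (MvPolynomial (Fin n) k ⧸ I) κ]
    [IsScalarTower k (MvPolynomial (Fin n) k ⧸ I) κ]
    (hη : ∀ q, algebraMap (MvPolynomial (Fin n) k ⧸ I) κ (Ideal.Quotient.mk I q) = aeval η q)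
    (S : Set (MvPolynomial (Fin n) k)) (hS : I = Ideal.span S) (hv : ∀ q ∈ S, dirDeriv η v q = 0) :
    ∃ δ : Derivation k (MvPolynomial (Fin n) k ⧸ I) κ,
      ∀ q, δ (Ideal.Quotient.mk I q) = dirDeriv η v q := by
  have hI : ∀ q ∈ I, aeval η q = 0 := fun q hq => by
    rw [← hη, Ideal.Quotient.eq_zero_iff_mem.2 hq, map_zero]
  have hker : I.restrictScalars k ≤ LinearMap.ker (dirDeriv (k := k) η v) := by
    intro q hq
    rw [Submodule.restrictScalars_mem, hS] at hq
    rw [LinearMap.mem_ker]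
    induction hq using Submodule.span_induction with
    | mem q hq => exact hv q hq
    | zero => simp
    | add p q _ _ hp hq => simp [hp, hq]
    | smul c q hq h => rw [smul_eq_mul, dirDeriv_mul, h, hI q (hS ▸ hq)]; simp
  let δ₀ : (MvPolynomial (Fin n) k ⧸ I) →ₗ[k] κ := (I.restrictScalars k).liftQ _ hker
  refine ⟨Derivation.mk' δ₀ fun a b => ?_, fun q => rfl⟩
  obtain ⟨p, rfl⟩ := Ideal.Quotient.mk_surjective a
  obtain ⟨q, rfl⟩ := Ideal.Quotient.mk_surjective b
  rw [Algebra.smul_def, Algebra.smul_def, hη, hη]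
  exact dirDeriv_mul η v p q

/-- If `V(F)` is smooth of codimension `R`, the Jacobian matrix has rank `R` at every point of `V(F)`.
The point has values in an arbitrary field extension and is normalized to lie in a standard chart. -/
theorem exists_minor_ne_zero [CharZero k] (F : Fin R → MvPolynomial (Fin n) k)
    (hsm : IsSmoothProj (formsIdeal F)) (hdim : projDim (formsIdeal F) = (n : ℤ) - 1 - R)
    {κ : Type*} [Field κ] [Algebra k κ] (η : Fin n → κ) (hF : ∀ l, aeval η (F l) = 0)
    {i : Fin n} (hi : η i = 1) :
    ∃ e : Fin R ↪ Fin n, aeval η ((jacobian F).submatrix id e).det ≠ 0 := by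
  by_contra! hminor
  set I := formsIdeal F ⊔ Ideal.span {X i - 1} with hIdef
  have hIspan : I = Ideal.span (Set.range F ∪ {X i - 1}) := (Ideal.span_union _ _).symm
  have hI : ∀ q ∈ I, aeval η q = 0 := by
    intro q hq
    have : I ≤ RingHom.ker (aeval (R := k) η) := by
      rw [hIspan, Ideal.span_le]
      rintro _ (⟨l, rfl⟩ | rfl)
      · exact hF l
      · simp [RingHom.mem_ker, hi]
    exact this hq
  let φ : (MvPolynomial (Fin n) k ⧸ I) →ₐ[k] κ := Ideal.Quotient.liftₐ I (aeval η) hI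
  let := φ.toRingHom.toAlgebra
  have : IsScalarTower k (MvPolynomial (Fin n) k ⧸ I) κ :=
    .of_algebraMap_eq' φ.comp_algebraMap.symm
  have : Algebra.Smooth k (MvPolynomial (Fin n) k ⧸ I) := hsm i
  obtain ⟨s, a, ha, hδ⟩ := exists_algebraicIndependent_of_smooth (k := k)
    (A := MvPolynomial (Fin n) k ⧸ I) (κ := κ)
  have hs : (s : ℤ) ≤ n - 1 - R := by
    rw [← hdim]
    refine le_projDim (i := i) ?_
    simpa using card_le_of_algebraicIndependent ha
  choose p hp using fun l => Ideal.Quotient.mk_surjective (a l)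
  let M : Matrix (Fin R) (Fin n) κ := (jacobian F).map (aeval η)
  let M' : Matrix (Fin s) (Fin n) κ := Matrix.of fun l j => aeval η (pderiv j (p l))
  have hrank : M.rank < R := by
    refine rank_lt_of_minors_eq_zero M fun e => ?_
    rw [← hminor e, AlgHom.map_det]
    rfl
  -- The kernel of the first two components is the tangent space of the chart at `η`, and the last
  -- component is injective on it. Hence `n ≤ (R - 1) + 1 + s`.
  let T : (Fin n → κ) →ₗ[κ] LinearMap.range M.mulVecLin × (κ × (Fin s → κ)) :=
    M.mulVecLin.rangeRestrict.prod ((LinearMap.proj i).prod M'.mulVecLin)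
  have hT : Function.Injective T := by
    rw [injective_iff_map_eq_zero]
    intro v hv
    have h1 : M.mulVecLin v = 0 := congrArg (fun x => (x.1 : Fin R → κ)) hv
    have h2 : v i = 0 := congrArg (fun x => x.2.1) hv
    have h3 : M'.mulVecLin v = 0 := congrArg (fun x => x.2.2) hv
    obtain ⟨δ, hδv⟩ := exists_derivation_quotient (k := k) η v I (fun q => rfl) _ hIspan (by
      rintro _ (⟨l, rfl⟩ | rfl)
      · exact congrFun h1 l
      · rw [map_sub, dirDeriv_X, h2]
        simp [dirDeriv])
    have h0 := hδ δ fun l => by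
      rw [← hp, hδv]
      exact congrFun h3 l
    funext j
    rw [← dirDeriv_X (k := k) η v j, ← hδv, h0]
    rfl
  have := LinearMap.finrank_le_finrank_of_injective hT
  simp only [Module.finrank_prod, Module.finrank_fin_fun, Module.finrank_self] at this
  change n ≤ M.rank + (1 + s) at this
  omega

/-! ### Evaluation of forms at scaled points -/

theorem aeval_mul_of_isHomogeneous {S : Type*} [CommRing S] [Algebra k S]
    {F : MvPolynomial (Fin n) k} {d : ℕ} (hF : F.IsHomogeneous d) (c : S) (ξ : Fin n → S) :
    aeval (fun j => c * ξ j) F = c ^ d * aeval ξ F := by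
  rw [F.as_sum]
  simp only [map_sum, Finset.mul_sum, aeval_monomial]
  refine Finset.sum_congr rfl fun m hm => ?_
  have hd : ∑ j ∈ m.support, m j = d := by
    have := hF (mem_support_iff.1 hm)
    simpa [Finsupp.weight_apply, Finsupp.sum] using this
  simp only [mul_pow, Finsupp.prod, Finset.prod_mul_distrib, Finset.prod_pow_eq_pow_sum]
  rw [hd]
  ring

/-- The locus where the maximal minors vanish is a cone. -/
theorem aeval_mul_minor_eq_zero {S : Type*} [CommRing S] [Algebra k S]
    {F : Fin R → MvPolynomial (Fin n) k} {d : ℕ} (hF : ∀ l, (F l).IsHomogeneous d) (c : S)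
    {ξ : Fin n → S} {e : Fin R ↪ Fin n} (h : aeval ξ ((jacobian F).submatrix id e).det = 0) :
    aeval (fun j => c * ξ j) ((jacobian F).submatrix id e).det = 0 := by
  have : (aeval (R := k) (fun j => c * ξ j)).mapMatrix ((jacobian F).submatrix id e) =
      c ^ (d - 1) • (aeval (R := k) ξ).mapMatrix ((jacobian F).submatrix id e) := by
    ext l j
    exact aeval_mul_of_isHomogeneous (hF l).pderiv c ξ
  rw [AlgHom.map_det, this, Matrix.det_smul, ← AlgHom.map_det, h, mul_zero]

/-! ### The affine cone over the rank locus -/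

/-- The coordinates of a point of the cone over the rank locus are integral over the values of the
forms at that point. -/
theorem isIntegral_of_minors_eq_zero [CharZero k] (F : Fin R → MvPolynomial (Fin n) k) {d : ℕ}
    (hd : d ≠ 0) (hF : ∀ l, (F l).IsHomogeneous d)
    (hsm : IsSmoothProj (formsIdeal F)) (hdim : projDim (formsIdeal F) = (n : ℤ) - 1 - R)
    {K : Type*} [Field K] [Algebra k K] (ξ : Fin n → K)
    (hξ : ∀ e : Fin R ↪ Fin n, aeval ξ ((jacobian F).submatrix id e).det = 0) (j : Fin n) :
    IsIntegral (Algebra.adjoin k (Set.range fun l => aeval ξ (F l))) (ξ j) := by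
  by_contra hj
  set B := Algebra.adjoin k (Set.range fun l => aeval ξ (F l)) with hB
  obtain ⟨V, hV, hjV⟩ := Subring.exists_le_valuationSubring_of_isIntegrallyClosedIn (x := ξ j)
    (R := (integralClosure B K).toSubring) hj
  have hBV : ∀ x ∈ B, x ∈ V := fun x hx =>
    hV ((integralClosure B K).algebraMap_mem (⟨x, hx⟩ : B))
  have : Nonempty (Fin n) := ⟨j⟩
  obtain ⟨m, hm⟩ := Finite.exists_max fun j => V.valuation (ξ j)
  have hm1 : 1 < V.valuation (ξ m) :=
    (not_le.1 fun h => hjV ((V.valuation_le_one_iff _).1 h)).trans_le (hm j)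
  have hm0 : ξ m ≠ 0 := by
    intro h
    simp [h] at hm1
  -- `η` is the point `ξ` divided by a coordinate of largest valuation, and `η'` its reduction.
  let η : Fin n → V := fun j => ⟨(ξ m)⁻¹ * ξ j, by
    rw [← V.valuation_le_one_iff, map_mul, map_inv₀]
    exact inv_mul_le_one_of_le₀ (hm j) zero_le⟩
  let := ((algebraMap k K).codRestrict V.toSubring fun x => hBV _ (B.algebraMap_mem x)).toAlgebra
  have : IsScalarTower k V K := .of_algebraMap_eq fun x => rfl
  have hη : ∀ p : MvPolynomial (Fin n) k,
      ((aeval η p : V) : K) = aeval (fun j => (ξ m)⁻¹ * ξ j) p := fun p =>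
    (aeval_algebraMap_apply K η p).symm
  let η' : Fin n → IsLocalRing.ResidueField V := fun j => IsLocalRing.residue V (η j)
  have hη' : ∀ p : MvPolynomial (Fin n) k, aeval η' p = IsLocalRing.residue V (aeval η p) :=
    fun p => aeval_algebraMap_apply _ η p
  obtain ⟨e, he⟩ := exists_minor_ne_zero F hsm hdim η' (i := m) (fun l => by
    rw [hη', IsLocalRing.residue_eq_zero_iff, V.valuation_lt_one_iff, hη,
      aeval_mul_of_isHomogeneous (hF l), map_mul, map_pow, map_inv₀]
    have h1 : V.valuation (aeval ξ (F l)) ≤ 1 :=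
      (V.valuation_le_one_iff _).2 (hBV _ (Algebra.subset_adjoin ⟨l, rfl⟩))
    exact (mul_le_of_le_one_right' h1).trans_lt
      (pow_lt_one₀ zero_le (inv_lt_one_of_one_lt₀ hm1) hd))
    (by
      have : η m = 1 := Subtype.ext (inv_mul_cancel₀ hm0)
      simp only [η', this, map_one])
  refine he ?_
  rw [hη']
  have : aeval η ((jacobian F).submatrix id e).det = 0 :=
    Subtype.ext ((hη _).trans (aeval_mul_minor_eq_zero hF _ (hξ e)))
  rw [this, map_zero]

/-- A point of the cone over the rank locus generates a field of transcendence degree less than `R`. -/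
theorem card_lt_of_minors_eq_zero [CharZero k] (F : Fin R → MvPolynomial (Fin n) k) {d : ℕ}
    (hd : d ≠ 0) (hF : ∀ l, (F l).IsHomogeneous d)
    (hsm : IsSmoothProj (formsIdeal F)) (hdim : projDim (formsIdeal F) = (n : ℤ) - 1 - R)
    {K : Type*} [Field K] [Algebra k K] (ξ : Fin n → K)
    (hgen : IntermediateField.adjoin k (Set.range ξ) = ⊤)
    (hξ : ∀ e : Fin R ↪ Fin n, aeval ξ ((jacobian F).submatrix id e).det = 0)
    {ι : Type*} [Fintype ι] {z : ι → K} (hz : AlgebraicIndependent k z) :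
    Fintype.card ι < R := by
  by_contra! hle
  set f : Fin R → K := fun l => aeval ξ (F l)
  have halg : Algebra.IsAlgebraic (Algebra.adjoin k (Set.range f)) K := by
    refine ⟨fun x => ?_⟩
    have hx : x ∈ IntermediateField.adjoin k (Set.range ξ) := hgen ▸ IntermediateField.mem_top
    induction hx using IntermediateField.adjoin_induction with
    | mem x hx =>
      obtain ⟨j, rfl⟩ := hx
      exact (isIntegral_of_minors_eq_zero F hd hF hsm hdim ξ hξ j).isAlgebraic
    | algebraMap x =>
      exact isAlgebraic_algebraMap (algebraMap k (Algebra.adjoin k (Set.range f)) x)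
    | add x y _ _ hx hy => exact hx.add hy
    | inv x _ hx => exact hx.inv
    | mul x y _ _ hx hy => exact hx.mul hy
  have htb : IsTranscendenceBasis k f := by
    refine Algebra.IsAlgebraic.isTranscendenceBasis_of_lift_le_trdeg_of_finite k f ?_
    have h := hz.lift_cardinalMk_le_trdeg
    simp only [Cardinal.mk_fintype, Cardinal.lift_natCast, Fintype.card_fin,
      Cardinal.nat_le_lift_iff] at h ⊢
    exact (Nat.cast_le.2 hle).trans h
  have hli := linearIndependent_D_of_isTranscendenceBasis htb
  let M : Matrix (Fin R) (Fin n) K := (jacobian F).map (aeval ξ)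
  have hrank : M.rank < R := by
    refine rank_lt_of_minors_eq_zero M fun e => ?_
    rw [← hξ e, AlgHom.map_det]
    rfl
  -- The differentials of the `F_l(ξ)` are the images of the rows of `M` under `eⱼ ↦ dξⱼ`.
  have hrow : LinearIndependent K M.row := by
    refine LinearIndependent.of_comp
      (Fintype.linearCombination K fun j => KaehlerDifferential.D k K (ξ j)) ?_
    convert hli with l
    exact (derivation_aeval _ ξ (F l)).symm
  simp [hrow.rank_matrix] at hrank

/-- The charts of the rank locus have dimension at most `R - 2`. -/
theorem chart_rankLocus_dim_lt [CharZero k] (F : Fin R → MvPolynomial (Fin n) k) {d : ℕ}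
    (hd : d ≠ 0) (hF : ∀ l, (F l).IsHomogeneous d)
    (hsm : IsSmoothProj (formsIdeal F)) (hdim : projDim (formsIdeal F) = (n : ℤ) - 1 - R)
    (i : Fin n) [Nontrivial (Chart (rankLocusIdeal F) i)] {s : ℕ}
    (hs : ringKrullDim (Chart (rankLocusIdeal F) i) = s) : s + 1 < R := by
  obtain ⟨s', g, hg, -, hs'⟩ := exists_integral_inj_ringKrullDim_eq k (Chart (rankLocusIdeal F) i)
  obtain rfl : s = s' := by exact_mod_cast hs.symm.trans hs'
  have hz : AlgebraicIndependent k fun l => g (X l) :=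
    (algebraicIndependent_X (Fin s) k).map' hg
  obtain ⟨p, hp, hy⟩ := exists_isPrime_algebraicIndependent_quotient hz
  let D := Chart (rankLocusIdeal F) i ⧸ p
  let π : MvPolynomial (Fin n) k →ₐ[k] D :=
    (Ideal.Quotient.mkₐ k p).comp (Ideal.Quotient.mkₐ k _)
  have hπ : Function.Surjective π :=
    (Ideal.Quotient.mkₐ_surjective k p).comp (Ideal.Quotient.mkₐ_surjective k _)
  let K := FractionRing (Polynomial D)
  let ι : Polynomial D →ₐ[k] K := IsScalarTower.toAlgHom k (Polynomial D) K
  have hι : Function.Injective ι := IsFractionRing.injective (Polynomial D) K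
  let x : Fin n → K := fun j => ι (Polynomial.C (π (X j)))
  let t : K := ι Polynomial.X
  have ht : t ≠ 0 := (map_ne_zero_iff ι hι).2 Polynomial.X_ne_zero
  have hx : ∀ q : MvPolynomial (Fin n) k, aeval x q = ι (Polynomial.C (π q)) := by
    intro q
    have : aeval x = (ι.comp (Algebra.ofId D (Polynomial D) |>.restrictScalars k)).comp π := by
      ext j
      simp [x]
    rw [this]
    rfl
  -- On the chart `xᵢ = 1`, so the parameter `t` is the coordinate `ξᵢ`.
  have hxi : x i = 1 := by
    have : π (X i) = 1 := by
      rw [← sub_eq_zero, ← map_one π, ← map_sub]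
      have h0 : Ideal.Quotient.mk (rankLocusIdeal F ⊔ Ideal.span {X i - 1}) (X i - 1) = 0 :=
        Ideal.Quotient.eq_zero_iff_mem.2
          (Ideal.mem_sup_right (Ideal.subset_span rfl))
      exact (congrArg (Ideal.Quotient.mk p) h0).trans (map_zero _)
    simp only [x, this, map_one]
  -- The generic point of the line through the point `x` of the chart.
  let ξ : Fin n → K := fun j => t * x j
  have hξ : ∀ e : Fin R ↪ Fin n, aeval ξ ((jacobian F).submatrix id e).det = 0 := by
    intro e
    refine aeval_mul_minor_eq_zero hF t ?_
    have h0 : Ideal.Quotient.mk (rankLocusIdeal F ⊔ Ideal.span {X i - 1})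
        ((jacobian F).submatrix id e).det = 0 :=
      Ideal.Quotient.eq_zero_iff_mem.2 (Ideal.mem_sup_left (Ideal.subset_span ⟨e, rfl⟩))
    have h1 : π ((jacobian F).submatrix id e).det = 0 :=
      (congrArg (Ideal.Quotient.mk p) h0).trans (map_zero _)
    rw [hx, h1, map_zero, map_zero]
  have hgen : IntermediateField.adjoin k (Set.range ξ) = ⊤ := by
    set E := IntermediateField.adjoin k (Set.range ξ)
    have hξE : ∀ j, ξ j ∈ E := fun j => IntermediateField.subset_adjoin k _ ⟨j, rfl⟩
    have htE : t ∈ E := by simpa [ξ, hxi] using hξE i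
    have hxE : ∀ j, x j ∈ E := fun j => by
      have := E.mul_mem (E.inv_mem htE) (hξE j)
      rwa [inv_mul_cancel_left₀ ht] at this
    have hC : ∀ a : D, ι (Polynomial.C a) ∈ E := by
      intro a
      obtain ⟨q, rfl⟩ := hπ a
      rw [← hx]
      induction q using MvPolynomial.induction_on with
      | C a => rw [aeval_C]; exact E.algebraMap_mem a
      | add p q hp hq => rw [map_add]; exact E.add_mem hp hq
      | mul_X p j hp => rw [map_mul, aeval_X]; exact E.mul_mem hp (hxE j)
    have hpoly : ∀ a : Polynomial D, ι a ∈ E := by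
      intro a
      induction a using Polynomial.induction_on' with
      | add p q hp hq => rw [map_add]; exact E.add_mem hp hq
      | monomial m a =>
        rw [← Polynomial.C_mul_X_pow_eq_monomial, map_mul, map_pow]
        exact E.mul_mem (hC a) (E.pow_mem htE m)
    rw [eq_top_iff]
    intro a _
    obtain ⟨b, c, -, rfl⟩ := IsFractionRing.div_surjective (A := Polynomial D) a
    exact E.div_mem (hpoly b) (hpoly c)
  have hind : AlgebraicIndependent k (ι ∘ Sum.elim (fun _ : Unit => (Polynomial.X : Polynomial D))
      (algebraMap D (Polynomial D) ∘ fun l => Ideal.Quotient.mk p (g (X l)))) :=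
    (hy.sumElim_comp (algebraicIndependent_unique_type_iff.2 (Polynomial.transcendental_X D))).map'
      hι
  have := card_lt_of_minors_eq_zero F hd hF hsm hdim ξ hgen hξ hind
  simpa [add_comm] using this

/-! ### Base change and the real singular loci -/

/-- Dimensions of charts do not grow under extension of the base field, because a Noether normalization
remains integral after the extension. -/
theorem ringKrullDim_chart_le_of_map_le {k' : Type*} [Field k'] [Algebra k k']
    {J : Ideal (MvPolynomial (Fin n) k)} {J' : Ideal (MvPolynomial (Fin n) k')}
    (h : J.map (map (algebraMap k k')) ≤ J') (i : Fin n) :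
    ringKrullDim (Chart J' i) ≤ ringKrullDim (Chart J i) := by
  have hle : J ⊔ Ideal.span {X i - 1} ≤
      (J' ⊔ Ideal.span {X i - 1}).comap (map (algebraMap k k')) := by
    rw [← Ideal.map_le_iff_le_comap, Ideal.map_sup, Ideal.map_span]
    refine sup_le_sup h ?_
    simp
  let ψ : Chart J i →+* Chart J' i := Ideal.quotientMap _ (map (algebraMap k k')) hle
  have hψ : ∀ q, ψ (Ideal.Quotient.mk _ q) = Ideal.Quotient.mk _ (map (algebraMap k k') q) :=
    fun q => Ideal.quotientMap_mk
  cases subsingleton_or_nontrivial (Chart J i) with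
  | inl _ =>
    have : Subsingleton (Chart J' i) := ψ.codomain_trivial
    rw [ringKrullDim_eq_bot_of_subsingleton]
    exact bot_le
  | inr _ =>
  obtain ⟨s, g, -, hi, hs⟩ := exists_integral_inj_ringKrullDim_eq k (Chart J i)
  -- The base change of the Noether normalization `g`.
  let g' : MvPolynomial (Fin s) k' →ₐ[k'] Chart J' i := aeval fun l => ψ (g (X l))
  let := g.toRingHom.toAlgebra
  let := g'.toRingHom.toAlgebra
  have hcomp : (algebraMap (MvPolynomial (Fin s) k') (Chart J' i)).comp (map (algebraMap k k')) =
      ψ.comp (algebraMap (MvPolynomial (Fin s) k) (Chart J i)) := by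
    refine MvPolynomial.ringHom_ext (fun a => ?_) fun l => ?_
    · change g' (map (algebraMap k k') (C a)) = ψ (g (C a))
      rw [map_C, ← algebraMap_eq, ← algebraMap_eq, g.commutes, g'.commutes]
      change _ = ψ (Ideal.Quotient.mk _ (C a))
      rw [hψ, map_C]
      rfl
    · change g' (map (algebraMap k k') (X l)) = ψ (g (X l))
      rw [map_X]
      exact aeval_X _ l
  have hint : Algebra.IsIntegral (MvPolynomial (Fin s) k') (Chart J' i) := by
    refine ⟨fun b => ?_⟩
    obtain ⟨q, rfl⟩ := Ideal.Quotient.mk_surjective b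
    induction q using MvPolynomial.induction_on with
    | C a =>
      have : Ideal.Quotient.mk (J' ⊔ Ideal.span {X i - 1}) (C a) =
          algebraMap (MvPolynomial (Fin s) k') (Chart J' i) (C a) := (g'.commutes a).symm
      rw [this]
      exact isIntegral_algebraMap
    | add p q hp hq => rw [map_add]; exact hp.add hq
    | mul_X p j hp =>
      rw [map_mul]
      refine hp.mul ?_
      have := IsIntegral.map_of_comp_eq _ ψ hcomp (hi (Ideal.Quotient.mk _ (X j)))
      rwa [hψ, map_X] at this
  refine (ringKrullDim_le_of_isIntegral (MvPolynomial (Fin s) k') (Chart J' i)).trans ?_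
  rw [hs]
  simp

theorem projDim_le_of_map_le {k' : Type*} [Field k'] [Algebra k k']
    {J : Ideal (MvPolynomial (Fin n) k)} {J' : Ideal (MvPolynomial (Fin n) k')}
    (h : J.map (map (algebraMap k k')) ≤ J') : projDim J' ≤ projDim J :=
  projDim_le_of_chart (neg_one_le_projDim J) fun i _ _ hs =>
    le_projDim (hs ▸ ringKrullDim_chart_le_of_map_le h i)

/-- Modulo the partial derivatives of `β · F`, the vector `β` is in the left kernel of the Jacobian
matrix; as some `βₗ` is a unit, all maximal minors vanish. -/
theorem map_rankLocusIdeal_le_singIdeal (F : Fin R → MvPolynomial (Fin n) ℤ) {β : Fin R → ℝ}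
    (hβ : β ≠ 0) : (rankLocusIdeal (overRat F)).map (map (algebraMap ℚ ℝ)) ≤
      singIdeal (realCombination F β) := by
  obtain ⟨l₀, hl₀⟩ := Function.ne_iff.1 hβ
  rw [rankLocusIdeal, Ideal.map_span, Ideal.span_le]
  rintro _ ⟨_, ⟨e, rfl⟩, rfl⟩
  let q := Ideal.Quotient.mk (singIdeal (realCombination F β))
  let N : Matrix (Fin R) (Fin R) (MvPolynomial (Fin n) ℝ ⧸ singIdeal (realCombination F β)) :=
    Matrix.of fun l j => q (pderiv (e j) (map (Int.castRingHom ℝ) (F l)))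
  have hdet : q (map (algebraMap ℚ ℝ) ((jacobian (overRat F)).submatrix id e).det) = N.det := by
    rw [RingHom.map_det, RingHom.map_det]
    congr 1
    ext l j
    simp only [RingHom.mapMatrix_apply, Matrix.map_apply, Matrix.submatrix_apply, id_eq, jacobian,
      Matrix.of_apply, overRat, N, ← pderiv_map, map_map]
    congr 4
  have hN : Matrix.vecMul (fun l => q (C (β l))) N = 0 := by
    funext j
    have : pderiv (e j) (realCombination F β) ∈ singIdeal (realCombination F β) :=
      Ideal.mem_sup_right (Ideal.subset_span ⟨e j, rfl⟩)
    have hsum : pderiv (e j) (realCombination F β) =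
        ∑ l, C (β l) * pderiv (e j) (map (Int.castRingHom ℝ) (F l)) := by
      simp [realCombination]
    rw [← Ideal.Quotient.eq_zero_iff_mem, hsum] at this
    change ∑ l, q (C (β l)) * q (pderiv (e j) (map (Int.castRingHom ℝ) (F l))) = 0
    simpa only [← map_mul, ← map_sum] using this
  have h0 : q (C (β l₀)) * N.det = 0 := by
    have := congrArg (fun v => Matrix.vecMul v N.adjugate l₀) hN
    simpa [Matrix.vecMul_vecMul, Matrix.mul_adjugate, Matrix.vecMul_smul, mul_comm] using this
  have hu : IsUnit (q (C (β l₀))) := ((isUnit_iff_ne_zero.2 hl₀).map C).map q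
  rw [SetLike.mem_coe, ← Ideal.Quotient.eq_zero_iff_mem]
  exact hdet.trans (hu.mul_right_eq_zero.1 h0)

end FormSystem

theorem lemma1 (d n R : ℕ) (hd : 2 ≤ d) (hR : 1 ≤ R)
    (F : Fin R → MvPolynomial (Fin n) ℤ) (hF : ∀ i, (F i).IsHomogeneous d)
    (hsmooth : FormSystem.IsSmoothProj (FormSystem.formsIdeal (FormSystem.overRat F)))
    (hdim : FormSystem.projDim (FormSystem.formsIdeal (FormSystem.overRat F))
      = (n : ℤ) - 1 - (R : ℤ)) :
    FormSystem.sigmaReal F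
        ≤ 1 + FormSystem.projDim (FormSystem.rankLocusIdeal (FormSystem.overRat F)) ∧
      1 + FormSystem.projDim (FormSystem.rankLocusIdeal (FormSystem.overRat F))
        ≤ (R : ℤ) - 1 := by
  constructor
  · obtain ⟨β, hβ, h⟩ := (FormSystem.isGreatest_sSup_singDims hR F).1
    rw [FormSystem.sigmaReal, h]
    gcongr
    exact FormSystem.projDim_le_of_map_le (FormSystem.map_rankLocusIdeal_le_singIdeal F hβ)
  · have : FormSystem.projDim (FormSystem.rankLocusIdeal (FormSystem.overRat F)) ≤ (R : ℤ) - 2 := by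
      refine FormSystem.projDim_le_of_chart (by omega) fun i _ s hs => ?_
      have := FormSystem.chart_rankLocus_dim_lt (FormSystem.overRat F) (d := d) (by omega)
        (fun l => (hF l).map _) hsmooth hdim i hs
      omega
    omega
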